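/- Let $(R,\mathfrak m)$ be a Noetherian local domain of Krull dimension $1$ with field of fractions $Q(R)$, and assume that its integral closure $\overline R\subseteq Q(R)$ is a discrete valuation ring, is finitely generated as an $R$-module, and that the induced map of residue class fields $R/\mathfrak m\to\overline R/\mathfrak n$ is an isomorphism, where $\mathfrak n$ is the maximal ideal of $\overline R$. Let $C=R:\overline R=\{f\in R : f\overline R\subseteq R\}$ be the conductor of $R$. For a nonzero fractionary ideal $J$ of $R$ put $J^{-1}=\{f\in Q(R): fJ\subseteq R\}$. The trace of a finitely generated $R$-module $M$ is the ideal $\operatorname{tr}(M)=\sum_{\varphi\in\operatorname{Hom}_R(M,R)}\varphi(M)$. An ideal of $R$ is called a trace ideal if it is the trace of some finitely generated $R$-module. For an ideal $I$ of $R$, let $\operatorname{subtr}(I)$ denote the largest (with respect to inclusion) trace ideal contained in $I$, that is, the sum of all trace ideals contained in $I$. Assume that $R$ is Gorenstein (that is, $R$ has finite injective dimension as a module over itself), and let $I$ be an ideal of $R$ with $C\subseteq I\subseteq R$. Then there exists an integer $k_0\ge 0$ such that $(I^{-1})^{k}=(I^{-1})^{k_0}$ for all $k\geq k_0$. Moreover,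 for every such $k_0$, setting $J=(I^{-1})^{k_0}$, the largest trace ideal $\operatorname{subtr}(I)$ contained in $I$ exists and $\operatorname{subtr}(I)=J^{-1}$. -/

import Mathlib

open scoped nonZeroDivisors

universe u

/-- The trace of an `R`-module `M`: the sum of the images of all `R`-linear maps `M → R`. -/
def Module.traceIdeal (R : Type*) [CommRing R] (M : Type*) [AddCommGroup M] [Module R M] :
    Ideal R :=
  ⨆ φ : M →ₗ[R] R, LinearMap.range φ

/-- An ideal is a trace ideal if it is the trace of some finitely generated module. (Every finitely
generated `R`-module is isomorphic to one in the universe of `R`, and the trace is invariant under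
isomorphism.) -/
def Ideal.IsTraceIdeal {R : Type u} [CommRing R] (I : Ideal R) : Prop :=
  ∃ (M : Type u) (_ : AddCommGroup M) (_ : Module R M),
    Module.Finite R M ∧ I = Module.traceIdeal R M

/-- The sum of all trace ideals contained in `I`. -/
def Ideal.subtr {R : Type u} [CommRing R] (I : Ideal R) : Ideal R :=
  sSup {T : Ideal R | T.IsTraceIdeal ∧ T ≤ I}

/-- A commutative ring is a Gorenstein local ring if it is a Noetherian local ring which has finite
injective dimension as a module over itself. -/
structure IsGorensteinLocalRing (R : Type u) [CommRing R] : Prop where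
  isNoetherianRing : IsNoetherianRing R
  isLocalRing : IsLocalRing R
  exists_injectiveDimensionLE :
    ∃ n : ℕ, CategoryTheory.HasInjectiveDimensionLE (ModuleCat.of R R) n

/-- The conductor `C = R : R̄` of `R`, where `R̄` is the integral closure of `R` in its fraction
field `K`, as an ideal of `R`. -/
def integralClosureConductor (R K : Type*) [CommRing R] [Field K] [Algebra R K] : Ideal R where
  carrier := {r | ∀ x ∈ integralClosure R K, ∃ s : R, algebraMap R K s = algebraMap R K r * x}
  zero_mem' := fun x _ => ⟨0, by simp⟩
  add_mem' := by
    intro a b ha hb x hx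
    obtain ⟨s, hs⟩ := ha x hx
    obtain ⟨t, ht⟩ := hb x hx
    exact ⟨s + t, by rw [map_add, map_add, add_mul, hs, ht]⟩
  smul_mem' := by
    intro c a ha x hx
    obtain ⟨s, hs⟩ := ha x hx
    exact ⟨c * s, by rw [smul_eq_mul, map_mul, map_mul, hs, mul_assoc]⟩

/-! ### Long exact sequences for contravariant `Ext`. -/

section Ext

open CategoryTheory Abelian

variable {R : Type u} [CommRing R] {M N P : Type u} [AddCommGroup M] [AddCommGroup N]
  [AddCommGroup P] [Module R M] [Module R N] [Module R P] {f : M →ₗ[R] N} {g : N →ₗ[R] P}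

/-! The engine is reflexivity: over a one-dimensional Gorenstein domain every nonzero ideal
satisfies `(I⁻¹)⁻¹ = I` (`inv_inv_coeIdeal`), deduced from the vanishing of `Ext²(-, R)` on finite
modules. The powers of `I⁻¹` ascend inside the integral closure, so they stabilise at an overring
`J`. Then `J⁻¹` is a trace ideal, and `I⁻¹ ≤ J` dualises to `J⁻¹ ≤ I`. Conversely, for a nonzero
trace ideal `T ≤ I`, `T⁻¹` is a ring containing `I⁻¹`, hence `J`; dualising gives `T ≤ J⁻¹`. -/

theorem ModuleCat.shortExact_of_linearMap (hf : Function.Injective f)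
    (hg : Function.Surjective g) (hfg : Function.Exact f g) :
    (ModuleCat.shortComplexOfCompEqZero f g hfg.linearMap_comp_eq_zero).ShortExact :=
  ModuleCat.shortComplex_shortExact _ hfg hf hg

theorem ModuleCat.subsingleton_ext_of_exact (hf : Function.Injective f)
    (hg : Function.Surjective g) (hfg : Function.Exact f g) (Y : ModuleCat.{u} R) (n : ℕ)
    (hM : Subsingleton (Ext (ModuleCat.of R M) Y n))
    (hP : Subsingleton (Ext (ModuleCat.of R P) Y n)) :
    Subsingleton (Ext (ModuleCat.of R N) Y n) := by
  refine subsingleton_of_forall_eq 0 fun e => ?_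
  obtain ⟨e', rfl⟩ := Ext.contravariant_sequence_exact₂
    (ModuleCat.shortExact_of_linearMap hf hg hfg) Y e
    (Subsingleton.elim (α := Ext (ModuleCat.of R M) Y n) _ _)
  rw [Subsingleton.elim (α := Ext (ModuleCat.of R P) Y n) e' 0, Ext.comp_zero]

theorem ModuleCat.subsingleton_ext_of_injective (hf : Function.Injective f)
    (hg : Function.Surjective g) (hfg : Function.Exact f g) (Y : ModuleCat.{u} R) (n : ℕ)
    (hN : Subsingleton (Ext (ModuleCat.of R N) Y n))
    (hP : Subsingleton (Ext (ModuleCat.of R P) Y (n + 1))) :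
    Subsingleton (Ext (ModuleCat.of R M) Y n) := by
  refine subsingleton_of_forall_eq 0 fun e => ?_
  obtain ⟨e', rfl⟩ := Ext.contravariant_sequence_exact₁
    (ModuleCat.shortExact_of_linearMap hf hg hfg) Y e (Nat.add_comm 1 n)
    (Subsingleton.elim (α := Ext (ModuleCat.of R P) Y (n + 1)) _ _)
  rw [Subsingleton.elim (α := Ext (ModuleCat.of R N) Y n) e' 0, Ext.comp_zero]

theorem ModuleCat.subsingleton_ext_of_surjective (hf : Function.Injective f)
    (hg : Function.Surjective g) (hfg : Function.Exact f g) (Y : ModuleCat.{u} R) (n : ℕ)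
    (hM : Subsingleton (Ext (ModuleCat.of R M) Y n))
    (hN : Subsingleton (Ext (ModuleCat.of R N) Y (n + 1))) :
    Subsingleton (Ext (ModuleCat.of R P) Y (n + 1)) := by
  refine subsingleton_of_forall_eq 0 fun e => ?_
  obtain ⟨e', rfl⟩ := Ext.contravariant_sequence_exact₃
    (ModuleCat.shortExact_of_linearMap hf hg hfg) Y e
    (Subsingleton.elim (α := Ext (ModuleCat.of R N) Y (n + 1)) _ _) (Nat.add_comm 1 n)
  rw [Subsingleton.elim (α := Ext (ModuleCat.of R M) Y n) e' 0, Ext.comp_zero]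

theorem ModuleCat.exists_extend_of_subsingleton_ext (hf : Function.Injective f)
    (hg : Function.Surjective g) (hfg : Function.Exact f g) {Q : Type u} [AddCommGroup Q]
    [Module R Q] (hP : Subsingleton (Ext (ModuleCat.of R P) (ModuleCat.of R Q) 1))
    (φ : M →ₗ[R] Q) : ∃ ψ : N →ₗ[R] Q, ψ ∘ₗ f = φ := by
  obtain ⟨e, he⟩ := Ext.contravariant_sequence_exact₁
    (ModuleCat.shortExact_of_linearMap hf hg hfg) (ModuleCat.of R Q)
    (Ext.mk₀ (ModuleCat.ofHom φ)) (add_zero 1)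
    (Subsingleton.elim (α := Ext (ModuleCat.of R P) (ModuleCat.of R Q) 1) _ _)
  obtain ⟨ψ, rfl⟩ := Ext.addEquiv₀.symm.surjective e
  refine ⟨ψ.hom, ?_⟩
  have : ModuleCat.ofHom f ≫ ψ = ModuleCat.ofHom φ := by
    apply Ext.addEquiv₀.symm.injective
    simpa using he
  exact congrArg ModuleCat.Hom.hom this

theorem ModuleCat.subsingleton_ext_of_free [Module.Free R M] (Y : ModuleCat.{u} R) (n : ℕ) :
    Subsingleton (Ext (ModuleCat.of R M) Y (n + 1)) := by
  have : Projective (ModuleCat.of R M) :=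
    (IsProjective.iff_projective (R := R) M).1 inferInstance
  exact HasProjectiveDimensionLT.subsingleton _ 1 (n + 1) (by omega) _

end Ext

/-! ### Vanishing of `Ext²(-, R)` in the Gorenstein case. -/

section

open CategoryTheory Abelian

variable {R : Type u} [CommRing R] [IsDomain R] [IsNoetherianRing R]

/-- In a one-dimensional local domain every residue field `R ⧸ p` is either free or embeds in
`R ⧸ (x)`, so the vanishing of `Ext` against `Y` propagates downwards to degree two. -/
theorem ModuleCat.subsingleton_ext_of_succ [IsLocalRing R] [Ring.KrullDimLE 1 R]
    (Y : ModuleCat.{u} R) (n : ℕ)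
    (h : ∀ (M : Type u) [AddCommGroup M] [Module R M] [Module.Finite R M],
      Subsingleton (Ext (ModuleCat.of R M) Y (n + 3)))
    (M : Type u) [AddCommGroup M] [Module R M] [Module.Finite R M] :
    Subsingleton (Ext (ModuleCat.of R M) Y (n + 2)) := by
  induction ‹Module.Finite R M› using
    IsNoetherianRing.induction_on_isQuotientEquivQuotientPrime R with
  | subsingleton N => exact ModuleCat.subsingleton_ext_of_free Y (n + 1)
  | exact N₁ N₂ N₃ f g hf hg hfg h₁ h₃ =>
    exact ModuleCat.subsingleton_ext_of_exact hf hg hfg Y _ h₁ h₃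
  | quotient N p e =>
    by_cases hp : p.1 = ⊥
    · have : Module.Free R N :=
        Module.Free.of_equiv (e.trans (Submodule.quotEquivOfEqBot _ hp)).symm
      exact ModuleCat.subsingleton_ext_of_free Y (n + 1)
    obtain ⟨x, hxp, hx0⟩ := Submodule.exists_mem_ne_zero_of_ne_bot hp
    have hpm := p.2.isMaximal_of_ne_bot hp
    have hx : Ideal.span {x} ≤ p.1 := (Ideal.span_singleton_le_iff_mem _).2 hxp
    have : Nontrivial (R ⧸ Ideal.span {x}) :=
      Ideal.Quotient.nontrivial_iff.2 (ne_top_of_le_ne_top p.2.ne_top hx)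
    -- Since `x` kills `R ⧸ (x)`, this associated prime is nonzero, hence maximal, hence equal to
    -- `p`.
    obtain ⟨q, hq⟩ := associatedPrimes.nonempty R (R ⧸ Ideal.span {x})
    obtain ⟨hqp, f, hf⟩ := (isAssociatedPrime_iff_exists_injective_linearMap _ _).1 hq
    have hq0 : q ≠ ⊥ := by
      intro hq0
      have hx1 : f (Ideal.Quotient.mk q x) = 0 := by
        have h1 : Ideal.Quotient.mk q x = x • (1 : R ⧸ q) := by
          rw [Algebra.smul_def, mul_one]; rfl
        rw [h1, map_smul]
        obtain ⟨y, hy⟩ := Ideal.Quotient.mk_surjective (f 1)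
        rw [← hy]
        exact Ideal.Quotient.eq_zero_iff_mem.2
          (Ideal.mul_mem_right _ _ (Ideal.mem_span_singleton_self x))
      have h2 := (map_eq_zero_iff f hf).1 hx1
      rw [Ideal.Quotient.eq_zero_iff_mem, hq0] at h2
      exact hx0 h2
    have hpq : p.1 = q := by
      rw [IsLocalRing.eq_maximalIdeal hpm,
        IsLocalRing.eq_maximalIdeal (hqp.isMaximal_of_ne_bot hq0)]
    refine ModuleCat.subsingleton_ext_of_injective (f := f ∘ₗ
      (e.trans (Submodule.quotEquivOfEq _ _ hpq)).toLinearMap)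
      (g := (LinearMap.range (f ∘ₗ
      (e.trans (Submodule.quotEquivOfEq _ _ hpq)).toLinearMap)).mkQ)
      (hf.comp (LinearEquiv.injective _))
      (Submodule.mkQ_surjective _) (LinearMap.exact_map_mkQ_range _) Y _ ?_ (h _)
    refine ModuleCat.subsingleton_ext_of_surjective (f := LinearMap.mulLeft R x)
      (g := (Ideal.span {x}).mkQ) (mul_right_injective₀ hx0) (Submodule.mkQ_surjective _) ?_ Y _
      (ModuleCat.subsingleton_ext_of_free Y n) (ModuleCat.subsingleton_ext_of_free Y (n + 1))
    intro y
    rw [Submodule.mkQ_apply, Submodule.Quotient.mk_eq_zero, Ideal.mem_span_singleton]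
    exact ⟨fun ⟨z, hz⟩ => ⟨z, hz.symm⟩, fun ⟨z, hz⟩ => ⟨z, hz.symm⟩⟩

theorem IsGorensteinLocalRing.subsingleton_ext_two [Ring.KrullDimLE 1 R]
    (hR : IsGorensteinLocalRing R) (M : Type u) [AddCommGroup M] [Module R M]
    [Module.Finite R M] :
    Subsingleton (Ext (ModuleCat.of R M) (ModuleCat.of R R) 2) := by
  have := hR.isLocalRing
  obtain ⟨n, hn⟩ := hR.exists_injectiveDimensionLE
  -- Descend from degree `n + 2`, beyond the injective dimension, to degree 2.
  have key : ∀ k, k ≤ n → ∀ (M : Type u) [AddCommGroup M] [Module R M] [Module.Finite R M],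
      Subsingleton (Ext (ModuleCat.of R M) (ModuleCat.of R R) (n - k + 2)) := by
    intro k
    induction k with
    | zero =>
      intro _ M _ _ _
      exact HasInjectiveDimensionLT.subsingleton _ (n + 1) _ (by omega) _
    | succ k ih =>
      intro hk M _ _ _
      refine ModuleCat.subsingleton_ext_of_succ _ _ ?_ M
      have : n - (k + 1) + 3 = n - k + 2 := by omega
      rw [this]
      exact ih (by omega)
  have h := key n le_rfl M
  rwa [Nat.sub_self] at h

end

/-! ### Reflexivity of nonzero ideals. -/

section

variable {R : Type u} [CommRing R] [IsDomain R] [IsNoetherianRing R] {K : Type*} [Field K]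
  [Algebra R K] [IsFractionRing R K]

omit [IsDomain R] [IsNoetherianRing R] in
theorem LinearMap.exists_algebraMap_eq {M : Type*} [AddCommGroup M] [Module R M]
    (l : M →ₗ[R] K) (hl : ∀ m, ∃ r : R, algebraMap R K r = l m) :
    ∃ φ : M →ₗ[R] R, ∀ m, algebraMap R K (φ m) = l m := by
  let e := LinearEquiv.ofInjective (Algebra.linearMap R K) (IsFractionRing.injective R K)
  exact ⟨e.symm.toLinearMap ∘ₗ l.codRestrict _ hl,
    fun m => congrArg Subtype.val (e.apply_symm_apply (l.codRestrict _ hl m))⟩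

/-- The obstruction lies in `Ext¹(range g, R)`, which vanishes because it sits between `Ext¹(P, R) =
0` and `Ext²(P ⧸ range g, R) = 0`. -/
theorem LinearMap.exists_extend_ker (hR : IsGorensteinLocalRing R) [Ring.KrullDimLE 1 R] {N P : Type u}
    [AddCommGroup N] [AddCommGroup P] [Module R N] [Module R P]
    [Module.Free R N] [Module.Free R P] [Module.Finite R P] (g : N →ₗ[R] P)
    (φ : LinearMap.ker g →ₗ[R] R) : ∃ ψ : N →ₗ[R] R, ∀ x : LinearMap.ker g, ψ x = φ x := by
  have h1 : Subsingleton (CategoryTheory.Abelian.Ext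
      (ModuleCat.of R (LinearMap.range g)) (ModuleCat.of R R) 1) :=
    ModuleCat.subsingleton_ext_of_injective (f := (LinearMap.range g).subtype)
      (g := (LinearMap.range g).mkQ) (Submodule.subtype_injective _)
      (Submodule.mkQ_surjective _) (LinearMap.exact_subtype_mkQ _) _ 1
      (ModuleCat.subsingleton_ext_of_free _ 0) (hR.subsingleton_ext_two _)
  obtain ⟨ψ, hψ⟩ := ModuleCat.exists_extend_of_subsingleton_ext
    (f := (LinearMap.ker g).subtype) (g := g.rangeRestrict) (Submodule.subtype_injective _)
    g.surjective_rangeRestrict (fun x => by simp [Subtype.ext_iff]) h1 φ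
  exact ⟨ψ, fun x => LinearMap.congr_fun hψ x⟩

omit [IsNoetherianRing R] in
theorem FractionalIdeal.mem_inv_coeIdeal {I : Ideal R} (hI : I ≠ ⊥) {x : K} :
    x ∈ (I : FractionalIdeal R⁰ K)⁻¹ ↔
      ∀ a ∈ I, ∃ r : R, algebraMap R K r = x * algebraMap R K a := by
  rw [FractionalIdeal.mem_inv_iff (by simpa using hI)]
  simp [FractionalIdeal.mem_coeIdeal, FractionalIdeal.mem_one_iff]

omit [IsNoetherianRing R] in
theorem FractionalIdeal.one_mem_inv_coeIdeal {I : Ideal R} (hI : I ≠ ⊥) :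
    (1 : K) ∈ (I : FractionalIdeal R⁰ K)⁻¹ :=
  (FractionalIdeal.mem_inv_coeIdeal hI).2 fun a _ => ⟨a, (one_mul _).symm⟩

theorem IsGorensteinLocalRing.inv_inv_coeIdeal [Ring.KrullDimLE 1 R]
    (hR : IsGorensteinLocalRing R) {I : Ideal R} (hI : I ≠ ⊥) :
    ((I : FractionalIdeal R⁰ K)⁻¹)⁻¹ = I := by
  have hI' : (I : FractionalIdeal R⁰ K) ≠ 0 := by simpa using hI
  have h0 : (I : FractionalIdeal R⁰ K)⁻¹ ≠ 0 := fun h => one_ne_zero (α := K)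
    ((FractionalIdeal.mem_zero_iff R⁰).1 (h ▸ FractionalIdeal.one_mem_inv_coeIdeal hI))
  have hinj := IsFractionRing.injective R K
  refine le_antisymm (fun x hx => ?_) fun x hx => ?_
  · obtain ⟨n, a, rfl⟩ := Submodule.fg_iff_exists_fin_generating_family.1
      (IsNoetherian.noetherian I)
    obtain ⟨i₀, hi₀⟩ : ∃ i, a i ≠ 0 := by
      by_contra! h
      exact hI (Submodule.span_eq_bot.2 (by rintro _ ⟨i, rfl⟩; exact h i))
    have hi₀' : algebraMap R K (a i₀) ≠ 0 := (map_ne_zero_iff _ hinj).2 hi₀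
    -- The kernel consists of the vectors proportional to the generators `a`; it is a copy of `I⁻¹`
    -- via `f ↦ f • a`. Under this identification `l` below is multiplication by `x`.
    let g : (Fin n → R) →ₗ[R] (Fin n × Fin n → R) := LinearMap.pi fun p =>
      a p.2 • LinearMap.proj p.1 - a p.1 • LinearMap.proj p.2
    have hg : ∀ y ∈ LinearMap.ker g, ∀ i j, a j * y i = a i * y j := fun y hy i j =>
      sub_eq_zero.1 (congrFun hy (i, j))
    let l : LinearMap.ker g →ₗ[R] K := LinearMap.mulLeft R (x * (algebraMap R K (a i₀))⁻¹) ∘ₗ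
      Algebra.linearMap R K ∘ₗ LinearMap.proj i₀ ∘ₗ (LinearMap.ker g).subtype
    have hl : ∀ y, ∃ r : R, algebraMap R K r = l y := by
      intro y
      obtain ⟨r, hr⟩ := (FractionalIdeal.mem_one_iff R⁰).1
        ((FractionalIdeal.mem_inv_iff h0).1 hx
        ((algebraMap R K (a i₀))⁻¹ * algebraMap R K (y.1 i₀)) <| by
          refine (FractionalIdeal.mem_inv_coeIdeal hI).2 fun b hb => ?_
          obtain ⟨r, hr⟩ : ∃ r, y.1 i₀ * b = a i₀ * r := by
            induction hb using Submodule.span_induction with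
            | mem b hb =>
              obtain ⟨j, rfl⟩ := hb
              exact ⟨y.1 j, by rw [mul_comm, hg y.1 y.2]⟩
            | zero => exact ⟨0, by simp⟩
            | add b c _ _ hb hc =>
              obtain ⟨r, hr⟩ := hb
              obtain ⟨s, hs⟩ := hc
              exact ⟨r + s, by rw [mul_add, mul_add, hr, hs]⟩
            | smul c b _ hb =>
              obtain ⟨r, hr⟩ := hb
              exact ⟨c * r, by rw [smul_eq_mul, mul_left_comm, hr, mul_left_comm]⟩
          refine ⟨r, ?_⟩
          rw [mul_assoc, ← map_mul, hr, map_mul, inv_mul_cancel_left₀ hi₀'])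
      exact ⟨r, hr.trans (mul_assoc _ _ _).symm⟩
    obtain ⟨φ, hφ⟩ := LinearMap.exists_algebraMap_eq l hl
    obtain ⟨ψ, hψ⟩ := LinearMap.exists_extend_ker hR g φ
    have ha : a ∈ LinearMap.ker g := by
      ext p
      exact sub_eq_zero.2 (mul_comm _ _)
    -- The vector `a` corresponds to `1 ∈ I⁻¹`, so `ψ a = x`; being defined on all of `Rⁿ`, `ψ`
    -- sends `a` to a combination of the `a i`.
    refine (FractionalIdeal.mem_coeIdeal _).2 ⟨ψ a, ?_, ?_⟩
    · rw [LinearMap.pi_apply_eq_sum_univ]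
      exact Ideal.sum_mem _ fun i _ => Ideal.mul_mem_right _ _ (Submodule.subset_span ⟨i, rfl⟩)
    · rw [hψ ⟨a, ha⟩, hφ]
      exact inv_mul_cancel_right₀ hi₀' x
  · refine (FractionalIdeal.mem_inv_iff h0).2 fun y hy => ?_
    rw [mul_comm]
    exact (FractionalIdeal.mem_inv_iff hI').1 hy x hx

end

/-! ### Stabilisation of powers and trace ideals. -/

section

variable {R : Type u} [CommRing R] [IsDomain R] {K : Type*} [Field K]
  [Algebra R K] [IsFractionRing R K]

theorem integralClosureConductor_ne_bot [Module.Finite R (integralClosure R K)] :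
    integralClosureConductor R K ≠ ⊥ := by
  have hfg : (Subalgebra.toSubmodule (integralClosure R K)).FG := Module.Finite.iff_fg.1 ‹_›
  obtain ⟨a, ha, h⟩ := FractionalIdeal.isFractional_of_fg (S := R⁰) hfg
  refine (Submodule.ne_bot_iff _).2 ⟨a, fun x hx => ?_, nonZeroDivisors.ne_zero ha⟩
  obtain ⟨s, hs⟩ := h x hx
  exact ⟨s, by rw [hs, Algebra.smul_def]⟩

theorem Ideal.ne_bot_of_integralClosureConductor_le [Module.Finite R (integralClosure R K)]
    {I : Ideal R} (hI : integralClosureConductor R K ≤ I) : I ≠ ⊥ :=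
  ne_bot_of_le_ne_bot integralClosureConductor_ne_bot hI

/-- The conductor is an ideal of the integral closure too, so `f` maps it into itself; the
determinant trick then applies. -/
theorem FractionalIdeal.isIntegral_of_mem_inv_coeIdeal [IsNoetherianRing R]
    [Module.Finite R (integralClosure R K)] {I : Ideal R}
    (hI : integralClosureConductor R K ≤ I) {f : K} (hf : f ∈ (I : FractionalIdeal R⁰ K)⁻¹) :
    IsIntegral R f := by
  have hf := (FractionalIdeal.mem_inv_coeIdeal
    (Ideal.ne_bot_of_integralClosureConductor_le hI)).1 hf
  have hinj := IsFractionRing.injective R K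
  refine isIntegral_of_smul_mem_submodule
    (Submodule.map (Algebra.linearMap R K) (integralClosureConductor R K)) ?_
    ((IsNoetherian.noetherian (integralClosureConductor R K)).map _) f ?_
  · rw [← Submodule.map_bot (Algebra.linearMap R K)]
    exact (Submodule.map_injective_of_injective hinj).ne integralClosureConductor_ne_bot
  · rintro _ ⟨c, hc, rfl⟩
    obtain ⟨r, hr⟩ := hf c (hI hc)
    refine ⟨r, fun x hx => ?_, hr⟩
    obtain ⟨s, hs⟩ := hc x hx
    have hsC : s ∈ integralClosureConductor R K := fun y hy => by
      obtain ⟨t, ht⟩ := hc (x * y) (mul_mem hx hy)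
      exact ⟨t, by rw [ht, hs, mul_assoc]⟩
    obtain ⟨t, ht⟩ := hf s (hI hsC)
    exact ⟨t, by rw [ht, hs, hr, mul_assoc]⟩

theorem FractionalIdeal.exists_pow_inv_coeIdeal_eq [IsNoetherianRing R]
    [Module.Finite R (integralClosure R K)] {I : Ideal R}
    (hI : integralClosureConductor R K ≤ I) :
    ∃ k₀ : ℕ, ∀ k ≥ k₀, (I : FractionalIdeal R⁰ K)⁻¹ ^ k₀ = (I : FractionalIdeal R⁰ K)⁻¹ ^ k := by
  have hI0 := Ideal.ne_bot_of_integralClosureConductor_le hI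
  set J := (I : FractionalIdeal R⁰ K)⁻¹
  have hJ : 1 ≤ J := FractionalIdeal.one_le.2 (FractionalIdeal.one_mem_inv_coeIdeal hI0)
  set A := Subalgebra.toSubmodule (integralClosure R K)
  have hA : ∀ k, ((J ^ k : FractionalIdeal R⁰ K) : Submodule R K) ≤ A := by
    intro k
    rw [FractionalIdeal.coe_pow]
    induction k with
    | zero =>
      rw [pow_zero, Submodule.one_le]
      exact one_mem (integralClosure R K)
    | succ k ih =>
      rw [pow_succ, Submodule.mul_le]
      exact fun x hx y hy => (integralClosure R K).mul_mem (ih hx)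
        (FractionalIdeal.isIntegral_of_mem_inv_coeIdeal hI hy)
  obtain ⟨k₀, hk₀⟩ := monotone_stabilizes_iff_noetherian.2
    (inferInstanceAs (IsNoetherian R (integralClosure R K)))
    ⟨fun k => Submodule.comap A.subtype (J ^ k : FractionalIdeal R⁰ K),
      fun m n hmn => Submodule.comap_mono (FractionalIdeal.coe_le_coe.2 (pow_le_pow_right₀ hJ hmn))⟩
  refine ⟨k₀, fun k hk => FractionalIdeal.coeToSubmodule_injective ?_⟩
  have h : Submodule.map A.subtype (Submodule.comap A.subtype (J ^ k₀ : FractionalIdeal R⁰ K)) =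
      Submodule.map A.subtype (Submodule.comap A.subtype (J ^ k : FractionalIdeal R⁰ K)) :=
    congrArg (Submodule.map A.subtype) (hk₀ k hk)
  rwa [Submodule.map_comap_subtype, Submodule.map_comap_subtype, inf_eq_right.2 (hA _),
    inf_eq_right.2 (hA _)] at h

omit [IsDomain R] in
theorem Module.mem_traceIdeal {M : Type*} [AddCommGroup M] [Module R M] (φ : M →ₗ[R] R) (m : M) :
    φ m ∈ Module.traceIdeal R M :=
  (le_iSup (fun φ : M →ₗ[R] R => LinearMap.range φ) φ) ⟨m, rfl⟩

/-- Multiplication by an element of the inverse of a trace ideal preserves the ideal. -/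
theorem Ideal.IsTraceIdeal.exists_mem_of_mem_inv {T : Ideal R} (hT : T.IsTraceIdeal) (h0 : T ≠ ⊥)
    {f : K} (hf : f ∈ (T : FractionalIdeal R⁰ K)⁻¹) {t : R} (ht : t ∈ T) :
    ∃ s ∈ T, algebraMap R K s = f * algebraMap R K t := by
  have hf := (FractionalIdeal.mem_inv_coeIdeal h0).1 hf
  obtain ⟨M, _, _, -, rfl⟩ := hT
  induction ht using Submodule.iSup_induction' with
  | mem φ t ht =>
    obtain ⟨m, rfl⟩ := ht
    -- As `f * φ` takes values in `R`, it is another functional on `M`.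
    obtain ⟨ψ, hψ⟩ := LinearMap.exists_algebraMap_eq
      (LinearMap.mulLeft R f ∘ₗ Algebra.linearMap R K ∘ₗ φ)
      fun m => hf _ (Module.mem_traceIdeal φ m)
    exact ⟨ψ m, Module.mem_traceIdeal ψ m, hψ m⟩
  | zero => exact ⟨0, zero_mem _, by simp⟩
  | add x y _ _ hx hy =>
    obtain ⟨a, ha, ha'⟩ := hx
    obtain ⟨b, hb, hb'⟩ := hy
    exact ⟨a + b, add_mem ha hb, by rw [map_add, map_add, mul_add, ha', hb']⟩

theorem Ideal.IsTraceIdeal.pow_le_inv {T I : Ideal R} (hT : T.IsTraceIdeal) (h0 : T ≠ ⊥)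
    (hTI : T ≤ I) (k : ℕ) :
    (I : FractionalIdeal R⁰ K)⁻¹ ^ k ≤ (T : FractionalIdeal R⁰ K)⁻¹ := by
  have hI0 : I ≠ ⊥ := ne_bot_of_le_ne_bot h0 hTI
  have hle : (I : FractionalIdeal R⁰ K)⁻¹ ≤ (T : FractionalIdeal R⁰ K)⁻¹ :=
    FractionalIdeal.inv_anti_mono (by simpa using h0) (by simpa using hI0)
      ((FractionalIdeal.coeIdeal_le_coeIdeal K).2 hTI)
  induction k with
  | zero =>
    rw [pow_zero, FractionalIdeal.one_le]
    exact FractionalIdeal.one_mem_inv_coeIdeal h0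
  | succ k ih =>
    rw [pow_succ, FractionalIdeal.mul_le]
    refine fun x hx y hy => (FractionalIdeal.mem_inv_coeIdeal h0).2 fun t ht => ?_
    obtain ⟨s, hs, hs'⟩ := hT.exists_mem_of_mem_inv h0 (hle hy) ht
    obtain ⟨r, hr⟩ := (FractionalIdeal.mem_inv_coeIdeal h0).1 (ih hx) s hs
    exact ⟨r, by rw [hr, hs', mul_assoc]⟩

/-- If `J` is an overring of `R`, then `R : J` is its own trace. -/
theorem Ideal.isTraceIdeal_of_coeIdeal_eq_inv [IsNoetherianRing R] {J : FractionalIdeal R⁰ K}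
    (hJ1 : 1 ≤ J) (hJ : J * J ≤ J) {T : Ideal R} (hT : (T : FractionalIdeal R⁰ K) = J⁻¹) :
    T.IsTraceIdeal := by
  have hJ0 : J ≠ 0 := by
    rintro rfl
    exact one_ne_zero (α := K)
      ((FractionalIdeal.mem_zero_iff R⁰).1 (FractionalIdeal.one_le.1 hJ1))
  have hinj := IsFractionRing.injective R K
  have hmem : ∀ t, t ∈ T ↔ ∀ y ∈ J, algebraMap R K t * y ∈ (1 : FractionalIdeal R⁰ K) := by
    intro t
    rw [← FractionalIdeal.mem_inv_iff hJ0, ← hT]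
    exact ⟨fun h => ⟨t, h, rfl⟩, fun ⟨s, hs, hst⟩ => hinj hst ▸ hs⟩
  refine ⟨T, inferInstance, inferInstance, inferInstance, le_antisymm
    (fun t ht => Module.mem_traceIdeal (Submodule.subtype T) ⟨t, ht⟩) (iSup_le ?_)⟩
  rintro φ _ ⟨t, rfl⟩
  refine (hmem _).2 fun j hj => ?_
  obtain ⟨t', ht'⟩ := (FractionalIdeal.mem_one_iff R⁰).1 ((hmem _).1 t.2 j hj)
  -- `T` is stable under `J` because `J * J ≤ J`; clearing the denominator of `j` then gives `φ (j *
  -- t) = j * φ t`.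
  have ht'T : t' ∈ T := (hmem _).2 fun y hy => by
    rw [ht', mul_assoc]
    exact (hmem _).1 t.2 _ (hJ (FractionalIdeal.mul_mem_mul hj hy))
  refine (FractionalIdeal.mem_one_iff R⁰).2 ⟨φ ⟨t', ht'T⟩, ?_⟩
  obtain ⟨a, s, hs, rfl⟩ := IsFractionRing.div_surjective (A := R) j
  have hs' : algebraMap R K s ≠ 0 := (map_ne_zero_iff _ hinj).2 (nonZeroDivisors.ne_zero hs)
  have hst : s • (⟨t', ht'T⟩ : T) = a • t := by
    refine Subtype.ext (hinj ?_)
    simp only [Submodule.coe_smul, smul_eq_mul, map_mul, ht']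
    field_simp
  have hφ := congrArg (algebraMap R K) (congrArg φ hst)
  simp only [map_smul, smul_eq_mul, map_mul] at hφ
  rw [← mul_div_assoc, eq_div_iff hs', mul_comm, hφ, mul_comm]

end

theorem mainTheorem7 {R : Type u} [CommRing R] [IsDomain R] [IsNoetherianRing R] [IsLocalRing R]
    {K : Type*} [Field K] [Algebra R K] [IsFractionRing R K]
    (hdim : ringKrullDim R = 1)
    [IsDiscreteValuationRing (integralClosure R K)]
    [Module.Finite R (integralClosure R K)]
    (hres : Function.Bijective
      (IsLocalRing.ResidueField.map (algebraMap R (integralClosure R K))))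
    (hR : IsGorensteinLocalRing R)
    (I : Ideal R) (hI : integralClosureConductor R K ≤ I) :
    (∃ k₀ : ℕ, ∀ k ≥ k₀, (I : FractionalIdeal R⁰ K)⁻¹ ^ k₀ = (I : FractionalIdeal R⁰ K)⁻¹ ^ k) ∧
    ∀ k₀ : ℕ,
      (∀ k ≥ k₀, (I : FractionalIdeal R⁰ K)⁻¹ ^ k₀ = (I : FractionalIdeal R⁰ K)⁻¹ ^ k) →
      IsGreatest {T : Ideal R | T.IsTraceIdeal ∧ T ≤ I} I.subtr ∧
      (I.subtr : FractionalIdeal R⁰ K) = ((I : FractionalIdeal R⁰ K)⁻¹ ^ k₀)⁻¹ := by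
  refine ⟨FractionalIdeal.exists_pow_inv_coeIdeal_eq hI, fun k₀ hk₀ => ?_⟩
  have : Ring.KrullDimLE 1 R := Ring.krullDimLE_iff.2 (by simp [hdim])
  have hI0 := Ideal.ne_bot_of_integralClosureConductor_le hI
  set L := (I : FractionalIdeal R⁰ K)⁻¹
  set J := L ^ k₀ with hJdef
  have hL1 : 1 ≤ L := FractionalIdeal.one_le.2 (FractionalIdeal.one_mem_inv_coeIdeal hI0)
  have hne : ∀ {A : FractionalIdeal R⁰ K}, 1 ≤ A → A ≠ 0 := by
    rintro _ h rfl
    exact one_ne_zero (α := K) ((FractionalIdeal.mem_zero_iff R⁰).1 (FractionalIdeal.one_le.1 h))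
  have hJ1 : 1 ≤ J := one_le_pow₀ hL1
  have hJJ : J * J ≤ J := by
    rw [hJdef, ← pow_add]
    exact (hk₀ _ (Nat.le_add_left _ _)).ge
  have hLJ : L ≤ J := by
    -- The exponent `k₀ + 1` also covers `k₀ = 0`.
    rw [hk₀ (k₀ + 1) (Nat.le_succ _), pow_succ]
    exact le_mul_of_one_le_left' hJ1
  have hJI : J⁻¹ ≤ (I : FractionalIdeal R⁰ K) := by
    rw [← hR.inv_inv_coeIdeal (K := K) hI0]
    exact FractionalIdeal.inv_anti_mono (hne hL1) (hne hJ1) hLJ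
  obtain ⟨T, hT⟩ := FractionalIdeal.le_one_iff_exists_coeIdeal.1
    (hJI.trans FractionalIdeal.coeIdeal_le_one)
  have hTI : T ≤ I := (FractionalIdeal.coeIdeal_le_coeIdeal K).1 (hT ▸ hJI)
  have hgreat : IsGreatest {T : Ideal R | T.IsTraceIdeal ∧ T ≤ I} T := by
    refine ⟨⟨Ideal.isTraceIdeal_of_coeIdeal_eq_inv hJ1 hJJ hT, hTI⟩, ?_⟩
    rintro S ⟨hS, hSI⟩
    -- Reflexivity is available only for nonzero ideals.
    by_cases hS0 : S = ⊥
    · exact hS0 ▸ bot_le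
    rw [← FractionalIdeal.coeIdeal_le_coeIdeal K, hT, ← hR.inv_inv_coeIdeal (K := K) hS0]
    exact FractionalIdeal.inv_anti_mono (hne hJ1) (hne (hJ1.trans (hS.pow_le_inv hS0 hSI k₀)))
      (hS.pow_le_inv hS0 hSI k₀)
  have hsub : I.subtr = T := hgreat.isLUB.sSup_eq
  rw [hsub]
  exact ⟨hgreat, hT⟩
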